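/- Let $(X,\mathscr A,\mu)$ be a $\sigma$-finite measure space, let $\phi\colon X\to X$ and $w\colon X\to\mathbb C$ be $\mathscr A$-measurable, and let $\mu_w(\sigma)=\int_\sigma |w|^2\,d\mu$ for $\sigma\in\mathscr A$. Assume that $\mu_w\circ\phi^{-1}\ll\mu$, and let $C_{\phi,w}$ be the weighted composition operator in the complex Hilbert space $L^2(\mu)$ given by $C_{\phi,w}f=w\cdot(f\circ\phi)$ on the domain $\{f\in L^2(\mu)\colon w\cdot(f\circ\phi)\in L^2(\mu)\}$. Suppose that $C_{\phi,w}$ is a bounded operator defined on the whole of $L^2(\mu)$, that it is injective, and that its range is dense in $L^2(\mu)$. Then: (1) the conditional expectation $\mathsf E_{\phi,w}$ with respect to the $\sigma$-algebra $\phi^{-1}(\mathscr A)$ and the measure $\mu_w$ is the identity: $\mathsf E_{\phi,w}f=f$ for every $f\in L^2(\mu_w)$ (where $\mathsf E_{\phi,w}$ is the orthogonal projection of $L^2(\mu_w)$ onto the subspace of classes of $\phi^{-1}(\mathscr A)$-measurable functions), and also $\mathsf E_{\phi,w}(f)=f$ a.e. $[\mu_w]$ for every $\mathscr A$-measurable $f\colon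 X\to[0,\infty]$; (2) $T=C_{\phi,w}$ is centered, i.e. the operators $T^nT^{n*}$, $T^{n*}T^n$ ($n\geqslant1$) commute with each other; (3) $T$ is type IV centered, i.e. $T$ is centered and its phase is unitary, where the phase of $T$ is the unique partial isometry $U$ with $\ker U=\ker T$ and $T=U|T|$, $|T|=(T^*T)^{1/2}$. -/

import Mathlib

open MeasureTheory Filter
open scoped ENNReal

noncomputable section

namespace WeightedComposition

section Wco

variable {X : Type*} [MeasurableSpace X]

/-- The measure `μ_w`, `μ_w(σ) = ∫_σ |w|² dμ`. -/
def weightedMeasure (μ : Measure X) (w : X → ℂ) : Measure X :=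
  μ.withDensity fun x => ‖w x‖ₑ ^ 2

/-- The standing condition under which `C_{φ,w}` is well defined: `μ_w ∘ φ⁻¹ ≪ μ`. -/
def IsAdmissible (μ : Measure X) (φ : X → X) (w : X → ℂ) : Prop :=
  (weightedMeasure μ w).map φ ≪ μ

/-- Under the standing condition, `w · (f ∘ φ)` only depends on the `μ`-a.e. class of `f`. -/
theorem weight_mul_comp_congr {μ : Measure X} {φ : X → X} {w : X → ℂ}
    (hφ : Measurable φ) (hw : Measurable w) (hac : IsAdmissible μ φ w)
    {f g : X → ℂ} (hfg : f =ᵐ[μ] g) :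
    (fun x => w x * f (φ x)) =ᵐ[μ] fun x => w x * g (φ x) := by
  have h1 : ∀ᵐ x ∂(weightedMeasure μ w), f (φ x) = g (φ x) :=
    ae_of_ae_map hφ.aemeasurable (hac.ae_le hfg)
  have hm : Measurable fun x => ‖w x‖ₑ ^ 2 := by fun_prop
  rw [weightedMeasure, ae_withDensity_iff hm] at h1
  filter_upwards [h1] with x hx
  by_cases h0 : w x = 0
  · simp [h0]
  · rw [hx (by simp [h0])]

/-- The weighted composition operator `C_{φ,w}` in `L²(μ)`, as a (possibly unbounded) operator:
its domain is `{f ∈ L²(μ) : w · (f ∘ φ) ∈ L²(μ)}` and `C_{φ,w} f = w · (f ∘ φ)`. -/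
def wco (μ : Measure X) (φ : X → X) (w : X → ℂ)
    (hφ : Measurable φ) (hw : Measurable w) (hac : IsAdmissible μ φ w) :
    Lp ℂ 2 μ →ₗ.[ℂ] Lp ℂ 2 μ where
  domain :=
    { carrier := {f | MemLp (fun x => w x * f (φ x)) 2 μ}
      zero_mem' := by
        refine MemLp.ae_eq (f := fun _ => (0 : ℂ)) ?_ MemLp.zero'
        refine EventuallyEq.trans ?_
          (weight_mul_comp_congr hφ hw hac (Lp.coeFn_zero ℂ 2 μ)).symm
        exact Eventually.of_forall fun x => by simp
      add_mem' := by
        intro f g hf hg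
        refine MemLp.ae_eq ?_ (hf.add hg)
        refine EventuallyEq.trans ?_
          (weight_mul_comp_congr hφ hw hac (Lp.coeFn_add f g)).symm
        exact Eventually.of_forall fun x => by simp [mul_add]
      smul_mem' := by
        intro c f hf
        refine MemLp.ae_eq ?_ (hf.const_smul c)
        refine EventuallyEq.trans ?_
          (weight_mul_comp_congr hφ hw hac (Lp.coeFn_smul c f)).symm
        exact Eventually.of_forall fun x => by simp [mul_left_comm] }
  toFun :=
    { toFun := fun f => MemLp.toLp (fun x => w x * (f : Lp ℂ 2 μ) (φ x)) f.2
      map_add' := by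
        intro f g
        rw [← MemLp.toLp_add]
        refine (MemLp.toLp_eq_toLp_iff _ _).2 ?_
        refine (weight_mul_comp_congr hφ hw hac
          (Lp.coeFn_add (f : Lp ℂ 2 μ) (g : Lp ℂ 2 μ))).trans ?_
        exact Eventually.of_forall fun x => by simp [mul_add]
      map_smul' := by
        intro c f
        rw [RingHom.id_apply, ← MemLp.toLp_const_smul]
        refine (MemLp.toLp_eq_toLp_iff _ _).2 ?_
        refine (weight_mul_comp_congr hφ hw hac
          (Lp.coeFn_smul c (f : Lp ℂ 2 μ))).trans ?_
        exact Eventually.of_forall fun x => by simp [mul_left_comm] }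

/-- `E_{φ,w}` as an operator on `L²(μ_w)`: the conditional expectation with respect to the
`σ`-algebra `φ⁻¹(𝒜)` and the measure `μ_w`, i.e. the orthogonal projection of `L²(μ_w)` onto the
subspace of classes of `φ⁻¹(𝒜)`-measurable functions. -/
def condExpOp (μ : Measure X) (φ : X → X) (w : X → ℂ) (hφ : Measurable φ) :
    Lp ℂ 2 (weightedMeasure μ w) →L[ℂ] Lp ℂ 2 (weightedMeasure μ w) :=
  (lpMeas ℂ ℂ (MeasurableSpace.comap φ inferInstance) 2 (weightedMeasure μ w)).subtypeL ∘L
    condExpL2 ℂ ℂ hφ.comap_le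

/-- `E_{φ,w}` on measurable functions `f : X → [0, ∞]`. -/
def condExpNonneg (μ : Measure X) (φ : X → X) (w : X → ℂ) (f : X → ℝ≥0∞) : X → ℝ≥0∞ :=
  condLExp (MeasurableSpace.comap φ inferInstance) (weightedMeasure μ w) f

end Wco

section Centered

variable {H : Type*} [NormedAddCommGroup H] [InnerProductSpace ℂ H] [CompleteSpace H]

/-- `T` is centered: the operators `…, T²T²*, TT*, T*T, T²*T², …` commute. -/
def IsCentered (T : H →L[ℂ] H) : Prop :=
  ∀ A B : H →L[ℂ] H,
    (∃ n : ℕ, 1 ≤ n ∧ (A = T ^ n * star (T ^ n) ∨ A = star (T ^ n) * T ^ n)) →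
    (∃ n : ℕ, 1 ≤ n ∧ (B = T ^ n * star (T ^ n) ∨ B = star (T ^ n) * T ^ n)) →
    Commute A B

/-- `U` is a partial isometry: it is isometric on the orthogonal complement of its kernel. -/
def IsPartialIsometry (U : H →L[ℂ] H) : Prop :=
  ∀ x ∈ (LinearMap.ker (U : H →ₗ[ℂ] H))ᗮ, ‖U x‖ = ‖x‖

/-- `U` is the phase of `T`: the (unique) partial isometry with `ker U = ker T` and `T = U|T|`,
where `|T|` is the square root of `T*T`. -/
def IsPhase (T U : H →L[ℂ] H) : Prop :=
  IsPartialIsometry U ∧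
    LinearMap.ker (U : H →ₗ[ℂ] H) = LinearMap.ker (T : H →ₗ[ℂ] H) ∧
    T = U * CFC.abs T

/-- `T` is type IV centered: it is centered and its phase is unitary. -/
def IsTypeIVCentered (T : H →L[ℂ] H) : Prop :=
  IsCentered T ∧ ∃ U : H →L[ℂ] H, IsPhase T U ∧ U ∈ unitary (H →L[ℂ] H)

end Centered

end WeightedComposition

end

/-! Multiplication by `w` maps `L²(μ_w)` isometrically into `L²(μ)` and takes `f ∘ φ` to `T f`
(`eLpNorm_weightedMeasure`). Hence dense range of `T` makes the functions `f ∘ φ` dense in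
`L²(μ_w)`. Their classes lie in the closed subspace of `φ⁻¹(𝒜)`-measurable ones, which is therefore
everything, and the conditional expectation is the identity.

So every bounded measurable `g` equals some bounded `k ∘ φ` a.e. `[μ_w]`, which gives `M_g T = T
M_k` and the same for the adjoints; conversely each `k` is matched by `g = k ∘ φ`. It follows that
all `TⁿTⁿ*` and `Tⁿ*Tⁿ` commute with the bounded multiplications. By σ-finiteness such operators are
themselves multiplications (`exists_mul_of_commute`), so they commute with each other.

Injectivity serves only the phase: `|T|` then has dense range, and `|T|x ↦ Tx` extends to a unitary.
-/

namespace WeightedComposition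

/-! ### Intertwining and centered operators; the unitary phase. -/

section Abstract

variable {H : Type*} [NormedAddCommGroup H] [InnerProductSpace ℂ H] [CompleteSpace H]

/-- `S` intertwines `F` and `G`, as well as their adjoints. -/
def StarIntertwines (S F G : H →L[ℂ] H) : Prop :=
  F * S = S * G ∧ star F * S = S * star G

theorem StarIntertwines.mul {S R F G K : H →L[ℂ] H} (h₁ : StarIntertwines S F G)
    (h₂ : StarIntertwines R G K) : StarIntertwines (S * R) F K :=
  ⟨by rw [← mul_assoc, h₁.1, mul_assoc, h₂.1, mul_assoc],
    by rw [← mul_assoc, h₁.2, mul_assoc, h₂.2, mul_assoc]⟩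

theorem StarIntertwines.mul_star_eq {S F G : H →L[ℂ] H} (h : StarIntertwines S F G) :
    G * star S = star S * F := by
  simpa using (congrArg star h.2).symm

theorem StarIntertwines.commute_mul_star {S F G : H →L[ℂ] H} (h : StarIntertwines S F G) :
    Commute F (S * star S) := by
  rw [Commute, SemiconjBy, ← mul_assoc, h.1, mul_assoc, h.mul_star_eq, mul_assoc]

theorem StarIntertwines.commute_star_mul {S F G : H →L[ℂ] H} (h : StarIntertwines S F G) :
    Commute G (star S * S) := by
  rw [Commute, SemiconjBy, ← mul_assoc, h.mul_star_eq, mul_assoc, h.1, mul_assoc]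

/-- Partners are chained along the powers. Starting from `F` serves `TⁿTⁿ*`; the mirror version,
starting from `G`, serves `Tⁿ*Tⁿ`. -/
theorem exists_starIntertwines_pow_right {M : Set (H →L[ℂ] H)} {T : H →L[ℂ] H}
    (h : ∀ F ∈ M, ∃ G ∈ M, StarIntertwines T F G) (n : ℕ) :
    ∀ F ∈ M, ∃ G ∈ M, StarIntertwines (T ^ n) F G := by
  induction n with
  | zero => exact fun F hF => ⟨F, hF, by simp [StarIntertwines]⟩
  | succ n ih =>
    intro F hF
    obtain ⟨G, hG, h₁⟩ := ih F hF
    obtain ⟨K, hK, h₂⟩ := h G hG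
    exact ⟨K, hK, pow_succ T n ▸ h₁.mul h₂⟩

theorem exists_starIntertwines_pow_left {M : Set (H →L[ℂ] H)} {T : H →L[ℂ] H}
    (h : ∀ G ∈ M, ∃ F ∈ M, StarIntertwines T F G) (n : ℕ) :
    ∀ G ∈ M, ∃ F ∈ M, StarIntertwines (T ^ n) F G := by
  induction n with
  | zero => exact fun F hF => ⟨F, hF, by simp [StarIntertwines]⟩
  | succ n ih =>
    intro G hG
    obtain ⟨F, hF, h₁⟩ := h G hG
    obtain ⟨K, hK, h₂⟩ := ih F hF
    exact ⟨K, hK, pow_succ T n ▸ h₂.mul h₁⟩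

/-- An operator that intertwines a set of operators with commutative commutant with itself, in
both directions, is centered. -/
theorem isCentered_of_starIntertwines {M : Set (H →L[ℂ] H)} {T : H →L[ℂ] H}
    (hr : ∀ F ∈ M, ∃ G ∈ M, StarIntertwines T F G)
    (hl : ∀ G ∈ M, ∃ F ∈ M, StarIntertwines T F G)
    (hM : ∀ A B : H →L[ℂ] H, (∀ F ∈ M, Commute F A) → (∀ F ∈ M, Commute F B) → Commute A B) :
    IsCentered T := by
  have key : ∀ A : H →L[ℂ] H,
      (∃ n : ℕ, 1 ≤ n ∧ (A = T ^ n * star (T ^ n) ∨ A = star (T ^ n) * T ^ n)) →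
      ∀ F ∈ M, Commute F A := by
    rintro A ⟨n, -, rfl | rfl⟩ F hF
    · obtain ⟨G, -, h⟩ := exists_starIntertwines_pow_right hr n F hF
      exact h.commute_mul_star
    · obtain ⟨G, -, h⟩ := exists_starIntertwines_pow_left hl n F hF
      exact h.commute_star_mul
  exact fun A B hA hB => hM A B (key A hA) (key B hB)

theorem norm_abs_apply (T : H →L[ℂ] H) (x : H) : ‖CFC.abs T x‖ = ‖T x‖ := by
  have hsa : star (CFC.abs T) = CFC.abs T := (CFC.abs_nonneg T).isSelfAdjoint.star_eq
  have h : star (CFC.abs T) * CFC.abs T = star T * T := by rw [hsa, CFC.abs_mul_abs]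
  have key : ∀ A : H →L[ℂ] H, ‖A x‖ ^ 2 = RCLike.re (inner ℂ ((star A * A) x) x) := fun A => by
    rw [ContinuousLinearMap.star_eq_adjoint]
    exact ContinuousLinearMap.apply_norm_sq_eq_inner_adjoint_left A x
  have h2 : ‖CFC.abs T x‖ ^ 2 = ‖T x‖ ^ 2 := by rw [key, key, h]
  exact (sq_eq_sq₀ (norm_nonneg _) (norm_nonneg _)).1 h2

/-- `|T|` is self-adjoint with the same kernel as `T`, so the orthogonal complement of its range is
trivial. -/
theorem denseRange_abs {T : H →L[ℂ] H} (hinj : Function.Injective T) :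
    DenseRange (CFC.abs T : H →L[ℂ] H) := by
  have hsa : ContinuousLinearMap.adjoint (CFC.abs T) = CFC.abs T :=
    (CFC.abs_nonneg T).isSelfAdjoint.star_eq
  have h : (CFC.abs T).rangeᗮ = ⊥ := by
    rw [ContinuousLinearMap.orthogonal_range, hsa, Submodule.eq_bot_iff]
    intro x hx
    have hx' : CFC.abs T x = 0 := hx
    have : ‖T x‖ = 0 := by rw [← norm_abs_apply, hx', norm_zero]
    exact hinj (by rw [norm_eq_zero.1 this, map_zero])
  have h2 : (CFC.abs T).range.topologicalClosure = ⊤ :=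
    (Submodule.topologicalClosure_eq_top_iff).2 h
  have h3 := (Submodule.dense_iff_topologicalClosure_eq_top).2 h2
  exact h3

/-- The phase of an injective operator with dense range is unitary. -/
theorem exists_isPhase_mem_unitary {T : H →L[ℂ] H} (hinj : Function.Injective T)
    (hdense : DenseRange T) : ∃ U : H →L[ℂ] H, IsPhase T U ∧ U ∈ unitary (H →L[ℂ] H) := by
  let e : H ≃ₗᵢ[ℂ] H := (LinearEquiv.refl ℂ H).extendOfIsometry ((CFC.abs T : H →L[ℂ] H) : H →ₗ[ℂ] H)
    (T : H →ₗ[ℂ] H) (denseRange_abs hinj) hdense fun x => (norm_abs_apply T x).symm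
  have he : ∀ x, e (CFC.abs T x) = T x := fun x =>
    LinearEquiv.extendOfIsometry_eq (LinearEquiv.refl ℂ H) ((CFC.abs T : H →L[ℂ] H) : H →ₗ[ℂ] H)
      (T : H →ₗ[ℂ] H) (denseRange_abs hinj) hdense (fun x => (norm_abs_apply T x).symm) x
  refine ⟨(Unitary.linearIsometryEquiv.symm e : unitary (H →L[ℂ] H)), ⟨?_, ?_, ?_⟩,
    SetLike.coe_mem _⟩
  · exact fun x _ => e.norm_map x
  · rw [LinearMap.ker_eq_bot.2 hinj]
    exact LinearMap.ker_eq_bot.2 e.injective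
  · ext x : 1
    exact (he x).symm

end Abstract

/-! ### The commutant of the bounded multiplication operators. -/

section MulOps

variable {X : Type*} [MeasurableSpace X]

/-- The operators of multiplication by a bounded measurable function on `L²(μ)`. -/
def boundedMulOps (μ : Measure X) : Set (Lp ℂ 2 μ →L[ℂ] Lp ℂ 2 μ) :=
  {A | ∃ g : X → ℂ, Measurable g ∧ (∃ C : ℝ, ∀ x, ‖g x‖ ≤ C) ∧
    ∀ f : Lp ℂ 2 μ, A f =ᵐ[μ] fun x => g x * f x}

theorem exists_mulOp (μ : Measure X) {g : X → ℂ} (hg : Measurable g) {C : ℝ}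
    (hC : ∀ x, ‖g x‖ ≤ C) :
    ∃ A ∈ boundedMulOps μ, ∀ f : Lp ℂ 2 μ, A f =ᵐ[μ] fun x => g x * f x := by
  have hmem : MemLp g ∞ μ := memLp_top_of_bound hg.aestronglyMeasurable C (.of_forall hC)
  have h : ∀ f : Lp ℂ 2 μ,
      (ContinuousLinearMap.mul ℂ ℂ).holderL μ ∞ 2 2 hmem.toLp f =ᵐ[μ] fun x => g x * f x := by
    intro f
    rw [ContinuousLinearMap.holderL_apply_apply]
    filter_upwards [(ContinuousLinearMap.mul ℂ ℂ).coeFn_holder (r := 2) hmem.toLp f,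
      hmem.coeFn_toLp] with x h1 h2
    rw [h1, h2]; rfl
  exact ⟨_, ⟨g, hg, ⟨C, hC⟩, h⟩, h⟩

theorem star_mulOp_apply {μ : Measure X} {A : Lp ℂ 2 μ →L[ℂ] Lp ℂ 2 μ} {g : X → ℂ}
    (hg : Measurable g) {C : ℝ} (hC : ∀ x, ‖g x‖ ≤ C)
    (hA : ∀ f : Lp ℂ 2 μ, A f =ᵐ[μ] fun x => g x * f x) (f : Lp ℂ 2 μ) :
    star A f =ᵐ[μ] fun x => star (g x) * f x := by
  obtain ⟨B, -, hB⟩ := exists_mulOp μ (g := fun x => star (g x))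
    (Complex.continuous_conj.measurable.comp hg) (C := C) (by simpa using hC)
  have h : B = ContinuousLinearMap.adjoint A := by
    rw [ContinuousLinearMap.eq_adjoint_iff]
    intro x y
    rw [L2.inner_def, L2.inner_def]
    refine integral_congr_ae ?_
    filter_upwards [hB x, hA y] with t h1 h2
    rw [h1, h2]
    simp only [RCLike.inner_apply, map_mul, RCLike.star_def, RCLike.conj_conj]
    ring
  rw [ContinuousLinearMap.star_eq_adjoint, ← h]
  exact hB f

/-- A σ-finite measure admits a nowhere vanishing square integrable function. -/
theorem exists_memLp_two_ne_zero (μ : Measure X) [SigmaFinite μ] :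
    ∃ u : X → ℂ, Measurable u ∧ MemLp u 2 μ ∧ ∀ x, u x ≠ 0 := by
  obtain ⟨g, hpos, hg, hint⟩ := exists_pos_lintegral_lt_of_sigmaFinite μ one_ne_zero
  have hm : Measurable fun x => ((NNReal.sqrt (g x) : ℝ) : ℂ) := by fun_prop
  refine ⟨_, hm, ?_, fun x => ?_⟩
  · rw [memLp_two_iff_integrable_sq_norm hm.aestronglyMeasurable]
    refine ⟨by fun_prop, ?_⟩
    refine lt_of_le_of_lt (lintegral_mono fun x => ?_) (hint.trans ENNReal.one_lt_top)
    have : ‖((NNReal.sqrt (g x) : ℝ) : ℂ)‖ ^ 2 = (g x : ℝ) := by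
      rw [Complex.norm_real, Real.norm_eq_abs, sq_abs, ← NNReal.coe_pow, NNReal.sq_sqrt]
    simp only [this]
    simp
  · simpa using (hpos x).ne'

/-- An operator commuting with all bounded multiplication operators is a multiplication. -/
theorem exists_mul_of_commute (μ : Measure X) [SigmaFinite μ] (A : Lp ℂ 2 μ →L[ℂ] Lp ℂ 2 μ)
    (hA : ∀ F ∈ boundedMulOps μ, Commute F A) :
    ∃ a : X → ℂ, ∀ f : Lp ℂ 2 μ, A f =ᵐ[μ] fun x => a x * f x := by
  obtain ⟨u, hu, hu2, hu0⟩ := exists_memLp_two_ne_zero μ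
  -- If `A` is multiplication by `a`, then `a = A u / u`.
  refine ⟨fun x => A hu2.toLp x / u x, fun f => ?_⟩
  have hf : Measurable f := (Lp.stronglyMeasurable f).measurable
  have hstep : ∀ n : ℕ, ∀ᵐ x ∂μ, ‖f x / u x‖ ≤ n → A f x = A hu2.toLp x / u x * f x := by
    intro n
    -- On `s` the function `f` is a bounded multiple of `u`: `1_s f = (1_s f / u) u`. Both
    -- multipliers commute with `A`, and these sets exhaust `X` as `n` grows.
    let s : Set X := {x | ‖f x / u x‖ ≤ n}
    have hs : MeasurableSet s := measurableSet_le (hf.div hu).norm measurable_const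
    obtain ⟨P, hPm, hP⟩ := exists_mulOp μ (g := s.indicator fun _ => (1 : ℂ))
      (measurable_const.indicator hs) (C := 1) (fun x => by
        by_cases hx : x ∈ s <;> simp [hx])
    obtain ⟨Q, hQm, hQ⟩ := exists_mulOp μ (g := s.indicator fun x => f x / u x)
      ((hf.div hu).indicator hs) (C := n) (fun x => by
        by_cases hx : x ∈ s
        · rw [Set.indicator_of_mem hx]; exact hx
        · simp [hx])
    have hPQ : P f = Q hu2.toLp := by
      refine Lp.ext ?_
      filter_upwards [hP f, hQ hu2.toLp, hu2.coeFn_toLp] with x h1 h2 h3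
      rw [h1, h2, h3]
      by_cases hx : x ∈ s
      · simp [hx, hu0 x]
      · simp [hx]
    have hcomm : P (A f) = Q (A hu2.toLp) :=
      calc P (A f) = A (P f) := DFunLike.congr_fun (hA P hPm).eq f
        _ = A (Q hu2.toLp) := by rw [hPQ]
        _ = Q (A hu2.toLp) := (DFunLike.congr_fun (hA Q hQm).eq hu2.toLp).symm
    filter_upwards [hP (A f), hQ (A hu2.toLp)] with x h1 h2 hx
    have hx' : x ∈ s := hx
    rw [hcomm, h2] at h1
    rw [Set.indicator_of_mem hx', Set.indicator_of_mem hx', one_mul] at h1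
    rw [← h1]; ring
  filter_upwards [ae_all_iff.2 hstep] with x hx
  obtain ⟨n, hn⟩ := exists_nat_ge ‖f x / u x‖
  exact hx n hn

theorem commute_of_commute_boundedMulOps (μ : Measure X) [SigmaFinite μ]
    (A B : Lp ℂ 2 μ →L[ℂ] Lp ℂ 2 μ) (hA : ∀ F ∈ boundedMulOps μ, Commute F A)
    (hB : ∀ F ∈ boundedMulOps μ, Commute F B) : Commute A B := by
  obtain ⟨a, ha⟩ := exists_mul_of_commute μ A hA
  obtain ⟨b, hb⟩ := exists_mul_of_commute μ B hB
  refine ContinuousLinearMap.ext fun f => Lp.ext ?_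
  change A (B f) =ᵐ[μ] B (A f)
  filter_upwards [ha (B f), hb (A f), ha f, hb f] with x h1 h2 h3 h4
  rw [h1, h2, h3, h4]; ring

end MulOps

/-! ### Consequences of dense range for `μ_w` and `φ⁻¹(𝒜)`. -/

section Range

variable {X : Type*} [MeasurableSpace X] {μ : Measure X} {φ : X → X} {w : X → ℂ}

theorem eLpNorm_weightedMeasure (μ : Measure X) (hw : Measurable w) (h : X → ℂ) :
    eLpNorm h 2 (weightedMeasure μ w) = eLpNorm (fun x => w x * h x) 2 μ := by
  rw [eLpNorm_eq_lintegral_rpow_enorm_toReal two_ne_zero ENNReal.ofNat_ne_top,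
    eLpNorm_eq_lintegral_rpow_enorm_toReal two_ne_zero ENNReal.ofNat_ne_top, weightedMeasure,
    lintegral_withDensity_eq_lintegral_mul_non_measurable μ (by fun_prop)
      (.of_forall fun x => ENNReal.pow_lt_top enorm_lt_top)]
  simp [enorm_mul, mul_pow]

instance sigmaFinite_weightedMeasure [SigmaFinite μ] : SigmaFinite (weightedMeasure μ w) :=
  SigmaFinite.withDensity_of_ne_top' fun _ => (ENNReal.pow_lt_top enorm_lt_top).ne

theorem memLp_mul_of_memLp_weightedMeasure (hw : Measurable w) {h : X → ℂ} (hm : Measurable h)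
    (hh : MemLp h 2 (weightedMeasure μ w)) : MemLp (fun x => w x * h x) 2 μ :=
  ⟨(hw.mul hm).aestronglyMeasurable, by rw [← eLpNorm_weightedMeasure μ hw]; exact hh.2⟩

theorem memLp_comp_weightedMeasure (hφ : Measurable φ) (hw : Measurable w) {f : X → ℂ}
    (hm : Measurable f) (hf : MemLp (fun x => w x * f (φ x)) 2 μ) :
    MemLp (fun x => f (φ x)) 2 (weightedMeasure μ w) :=
  ⟨(hm.comp hφ).aestronglyMeasurable, by
    rw [eLpNorm_weightedMeasure μ hw fun x => f (φ x)]; exact hf.2⟩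

theorem apply_eq_of_wco_eq (hφ : Measurable φ) (hw : Measurable w) (hac : IsAdmissible μ φ w)
    {T : Lp ℂ 2 μ →L[ℂ] Lp ℂ 2 μ}
    (hT : wco μ φ w hφ hw hac = LinearMap.toPMap (T : Lp ℂ 2 μ →ₗ[ℂ] Lp ℂ 2 μ) ⊤)
    (f : Lp ℂ 2 μ) : T f =ᵐ[μ] fun x => w x * f (φ x) := by
  have hf : f ∈ (wco μ φ w hφ hw hac).domain := by
    rw [hT]; exact Submodule.mem_top
  have key : ∀ {P Q : Lp ℂ 2 μ →ₗ.[ℂ] Lp ℂ 2 μ}, P = Q → ∀ (hP : f ∈ P.domain)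
      (hQ : f ∈ Q.domain), P ⟨f, hP⟩ = Q ⟨f, hQ⟩ := by
    rintro P _ rfl hP hQ; rfl
  have h : MemLp.toLp (fun x => w x * f (φ x)) hf = T f := key hT hf Submodule.mem_top
  rw [← h]
  exact MemLp.coeFn_toLp _

variable (hφ : Measurable φ) (hw : Measurable w) {T : Lp ℂ 2 μ →L[ℂ] Lp ℂ 2 μ}
  (hT : ∀ f : Lp ℂ 2 μ, T f =ᵐ[μ] fun x => w x * f (φ x))

include hφ hw hT

/-- If the range of the operator is dense, every class in `L²(μ_w)` is that of a
`φ⁻¹(𝒜)`-measurable function. -/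
theorem aestronglyMeasurable_comap_of_memLp (hdense : DenseRange T) {h : X → ℂ}
    (hm : Measurable h) (hh : MemLp h 2 (weightedMeasure μ w)) :
    AEStronglyMeasurable[MeasurableSpace.comap φ inferInstance] h (weightedMeasure μ w) := by
  have hclosed := isClosed_aestronglyMeasurable (F := ℂ) (p := 2) (μ := weightedMeasure μ w)
    hφ.comap_le
  suffices hmem : hh.toLp ∈ closure {f : Lp ℂ 2 (weightedMeasure μ w) |
      AEStronglyMeasurable[MeasurableSpace.comap φ inferInstance] f (weightedMeasure μ w)} by
    rw [hclosed.closure_eq] at hmem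
    exact AEStronglyMeasurable.congr hmem hh.coeFn_toLp
  rw [Metric.mem_closure_iff]
  intro ε hε
  have hwh := memLp_mul_of_memLp_weightedMeasure hw hm hh
  obtain ⟨f, hf⟩ := hdense.exists_dist_lt hwh.toLp hε
  have hfm : Measurable f := (Lp.stronglyMeasurable f).measurable
  have hfL := memLp_comp_weightedMeasure hφ hw hfm (MemLp.ae_eq (hT f) (Lp.memLp (T f)))
  refine ⟨hfL.toLp, ?_, ?_⟩
  · refine AEStronglyMeasurable.congr (StronglyMeasurable.aestronglyMeasurable ?_)
      hfL.coeFn_toLp.symm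
    exact (hfm.comp (comap_measurable φ)).stronglyMeasurable
  -- The isometry carries the distance in `L²(μ_w)` to the one in `L²(μ)`.
  · refine lt_of_eq_of_lt ?_ hf
    rw [Lp.dist_def, Lp.dist_def]
    congr 1
    calc _ = eLpNorm (fun x => h x - f (φ x)) 2 (weightedMeasure μ w) :=
          eLpNorm_congr_ae (hh.coeFn_toLp.sub hfL.coeFn_toLp)
      _ = eLpNorm (fun x => w x * h x - w x * f (φ x)) 2 μ := by
          rw [eLpNorm_weightedMeasure μ hw]; simp only [mul_sub]
      _ = _ := (eLpNorm_congr_ae (hwh.coeFn_toLp.sub (hT f))).symm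

/-- Since `μ_w` may be infinite, `g` need not be in `L²(μ_w)`; it is recovered as `(g u) / u` with
`u` nowhere zero and square integrable. -/
theorem aestronglyMeasurable_comap_of_bounded [SigmaFinite μ] (hdense : DenseRange T)
    {g : X → ℂ} (hg : Measurable g) {C : ℝ} (hC : ∀ x, ‖g x‖ ≤ C) :
    AEStronglyMeasurable[MeasurableSpace.comap φ inferInstance] g (weightedMeasure μ w) := by
  obtain ⟨u, hu, hu2, hu0⟩ := exists_memLp_two_ne_zero (weightedMeasure μ w)
  have h1 := aestronglyMeasurable_comap_of_memLp hφ hw hT hdense hu hu2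
  have h2 := aestronglyMeasurable_comap_of_memLp hφ hw hT hdense (hg.mul hu)
    (hu2.of_le_mul (c := C) (hg.mul hu).aestronglyMeasurable (.of_forall fun x => by
      rw [Pi.mul_apply, norm_mul]; gcongr; exact hC x))
  obtain ⟨u', hu', he1⟩ := h1
  obtain ⟨v', hv', he2⟩ := h2
  refine ⟨v' / u', (hv'.measurable.div hu'.measurable).stronglyMeasurable, ?_⟩
  filter_upwards [he1, he2] with x h1 h2
  rw [Pi.div_apply, ← h1, ← h2, Pi.mul_apply, mul_div_cancel_right₀ _ (hu0 x)]

/-- If the range of the operator is dense, every bounded measurable function is `μ_w`-a.e. the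
composition of a bounded measurable function with `φ`. -/
theorem exists_bounded_ae_eq_comp [SigmaFinite μ] (hdense : DenseRange T)
    {g : X → ℂ} (hg : Measurable g) {C : ℝ} (hC : ∀ x, ‖g x‖ ≤ C) :
    ∃ k : X → ℂ, Measurable k ∧ (∀ x, ‖k x‖ ≤ |C|) ∧
      ∀ᵐ x ∂weightedMeasure μ w, g x = k (φ x) := by
  obtain ⟨g', hg', he⟩ := aestronglyMeasurable_comap_of_bounded hφ hw hT hdense hg hC
  obtain ⟨k, hk, rfl⟩ := hg'.measurable.exists_eq_measurable_comp
  -- The factor `k` is controlled only at `φ x` for a.e. `x`, so it is cut off to be bounded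
  -- everywhere.
  have hs : MeasurableSet {y | ‖k y‖ ≤ |C|} := measurableSet_le hk.norm measurable_const
  refine ⟨{y | ‖k y‖ ≤ |C|}.indicator k, hk.indicator hs, fun x => ?_, ?_⟩
  · by_cases hx : x ∈ {y | ‖k y‖ ≤ |C|}
    · rw [Set.indicator_of_mem hx]; exact hx
    · rw [Set.indicator_of_notMem hx]; simp
  · filter_upwards [he] with x hx
    have hx' : φ x ∈ {y | ‖k y‖ ≤ |C|} := by
      change ‖(k ∘ φ) x‖ ≤ |C|
      rw [← hx]; exact (hC x).trans (le_abs_self C)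
    rw [Set.indicator_of_mem hx', hx]; rfl

/-- The injection `t ↦ (1 + t)⁻¹` of `[0, ∞]` into `[0, 1]` reduces this to bounded functions; `s ↦
s⁻¹ - 1` undoes it, infinite values included. -/
theorem exists_measurable_comap_ae_eq [SigmaFinite μ] (hdense : DenseRange T)
    {f : X → ℝ≥0∞} (hf : Measurable f) :
    ∃ f' : X → ℝ≥0∞, Measurable[MeasurableSpace.comap φ inferInstance] f' ∧
      f =ᵐ[weightedMeasure μ w] f' := by
  have hle : ∀ x, (1 + f x)⁻¹ ≤ 1 := fun x => ENNReal.inv_le_one.2 le_self_add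
  have hm : Measurable fun x => (((1 + f x)⁻¹.toReal : ℝ) : ℂ) := by fun_prop
  obtain ⟨g, hg, he⟩ := aestronglyMeasurable_comap_of_bounded hφ hw hT hdense hm (C := 1)
    (fun x => by
      rw [Complex.norm_real, Real.norm_of_nonneg ENNReal.toReal_nonneg]
      exact ENNReal.toReal_le_of_le_ofReal zero_le_one (by simp))
  have hgm := hg.measurable
  have hcont : Measurable fun z : ℂ => (ENNReal.ofReal z.re)⁻¹ - 1 := by fun_prop
  refine ⟨fun x => (ENNReal.ofReal (g x).re)⁻¹ - 1, hcont.comp hgm, ?_⟩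
  filter_upwards [he] with x hx
  rw [← hx, Complex.ofReal_re,
    ENNReal.ofReal_toReal (ne_top_of_le_ne_top ENNReal.one_ne_top (hle x)), inv_inv]
  simp

/-- The restriction of `μ_w` to `φ⁻¹(𝒜)` is σ-finite. -/
theorem sigmaFinite_trim_weightedMeasure [SigmaFinite μ] (hac : IsAdmissible μ φ w) :
    SigmaFinite ((weightedMeasure μ w).trim hφ.comap_le) := by
  refine ⟨⟨⟨fun n => φ ⁻¹' spanningSets μ n, fun _ => trivial, fun n => ?_, ?_⟩⟩⟩
  · have hs := measurableSet_spanningSets μ n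
    rw [trim_measurableSet_eq hφ.comap_le ⟨_, hs, rfl⟩]
    -- As `T` is defined on this indicator, its composition with `φ` is in `L²(μ_w)`, so the
    -- preimage has finite `μ_w`-measure.
    have hi : MemLp ((spanningSets μ n).indicator fun _ => (1 : ℂ)) 2 μ :=
      memLp_indicator_const 2 hs 1 (Or.inr (measure_spanningSets_lt_top μ n).ne)
    have h1 := MemLp.ae_eq ((hT hi.toLp).trans (weight_mul_comp_congr hφ hw hac hi.coeFn_toLp))
      (Lp.memLp _)
    have h2 := (memLp_comp_weightedMeasure hφ hw (measurable_const.indicator hs) h1).2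
    have h3 : (fun x => (spanningSets μ n).indicator (fun _ => (1 : ℂ)) (φ x)) =
        (φ ⁻¹' spanningSets μ n).indicator fun _ => (1 : ℂ) := rfl
    rw [h3, eLpNorm_indicator_const (hφ hs) two_ne_zero ENNReal.ofNat_ne_top] at h2
    by_contra htop
    rw [not_lt, top_le_iff] at htop
    rw [htop] at h2
    simp at h2
  · rw [← Set.preimage_iUnion, iUnion_spanningSets, Set.preimage_univ]

theorem condExpOp_eq_id (hdense : DenseRange T) :
    condExpOp μ φ w hφ = ContinuousLinearMap.id ℂ (Lp ℂ 2 (weightedMeasure μ w)) := by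
  ext1 f
  have hmem : f ∈ lpMeas ℂ ℂ (MeasurableSpace.comap φ inferInstance) 2 (weightedMeasure μ w) :=
    mem_lpMeas_iff_aestronglyMeasurable.2 (aestronglyMeasurable_comap_of_memLp hφ hw hT hdense
      (Lp.stronglyMeasurable f).measurable (Lp.memLp f))
  have : Fact (MeasurableSpace.comap φ inferInstance ≤ (inferInstance : MeasurableSpace X)) :=
    ⟨hφ.comap_le⟩
  exact Submodule.starProjection_eq_self_iff.2 hmem

theorem condExpNonneg_ae_eq [SigmaFinite μ] (hac : IsAdmissible μ φ w) (hdense : DenseRange T)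
    {f : X → ℝ≥0∞} (hf : Measurable f) :
    condExpNonneg μ φ w f =ᵐ[weightedMeasure μ w] f := by
  have := sigmaFinite_trim_weightedMeasure hφ hw hT hac
  obtain ⟨f', hf', he⟩ := exists_measurable_comap_ae_eq hφ hw hT hdense hf
  refine (condLExp_congr_ae he).trans ?_
  rw [condLExp_eq_self hφ.comap_le _ hf']
  exact he.symm

theorem starIntertwines_mulOp (hac : IsAdmissible μ φ w) {F G : Lp ℂ 2 μ →L[ℂ] Lp ℂ 2 μ}
    {g k : X → ℂ} (hg : Measurable g) (hk : Measurable k) {C D : ℝ} (hC : ∀ x, ‖g x‖ ≤ C)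
    (hD : ∀ x, ‖k x‖ ≤ D) (hF : ∀ f : Lp ℂ 2 μ, F f =ᵐ[μ] fun x => g x * f x)
    (hG : ∀ f : Lp ℂ 2 μ, G f =ᵐ[μ] fun x => k x * f x)
    (hgk : ∀ᵐ x ∂weightedMeasure μ w, g x = k (φ x)) : StarIntertwines T F G := by
  -- Agreement off the zeros of `w` suffices, because `T f` vanishes at those zeros.
  have hgk' : ∀ᵐ x ∂μ, w x ≠ 0 → g x = k (φ x) := by
    rw [weightedMeasure, ae_withDensity_iff (by fun_prop)] at hgk
    filter_upwards [hgk] with x hx h0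
    exact hx (by simp [h0])
  -- Kept general so as to apply again to the adjoints, with conjugated multipliers.
  have key : ∀ {F G : Lp ℂ 2 μ →L[ℂ] Lp ℂ 2 μ} {g k : X → ℂ},
      (∀ f : Lp ℂ 2 μ, F f =ᵐ[μ] fun x => g x * f x) →
      (∀ f : Lp ℂ 2 μ, G f =ᵐ[μ] fun x => k x * f x) →
      (∀ᵐ x ∂μ, w x ≠ 0 → g x = k (φ x)) → F * T = T * G := by
    intro F G g k hF hG hgk
    refine ContinuousLinearMap.ext fun f => Lp.ext ?_
    change F (T f) =ᵐ[μ] T (G f)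
    filter_upwards [hF (T f), hT f, hT (G f), weight_mul_comp_congr hφ hw hac (hG f), hgk]
      with x h1 h2 h3 h4 h5
    rw [h1, h2, h3, h4]
    by_cases h0 : w x = 0
    · simp [h0]
    · rw [h5 h0]; ring
  exact ⟨key hF hG hgk', key (star_mulOp_apply hg hC hF) (star_mulOp_apply hk hD hG)
    (hgk'.mono fun x hx h0 => by rw [hx h0])⟩

theorem isCentered_of_denseRange [SigmaFinite μ] (hac : IsAdmissible μ φ w)
    (hdense : DenseRange T) : IsCentered T := by
  refine isCentered_of_starIntertwines (M := boundedMulOps μ) ?_ ?_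
    (commute_of_commute_boundedMulOps μ)
  · rintro F ⟨g, hg, ⟨C, hC⟩, hF⟩
    obtain ⟨k, hk, hD, hgk⟩ := exists_bounded_ae_eq_comp hφ hw hT hdense hg hC
    obtain ⟨G, hGm, hG⟩ := exists_mulOp μ hk hD
    exact ⟨G, hGm, starIntertwines_mulOp hφ hw hT hac hg hk hC hD hF hG hgk⟩
  -- This direction needs no density: `k ∘ φ` is the partner.
  · rintro G ⟨k, hk, ⟨D, hD⟩, hG⟩
    obtain ⟨F, hFm, hF⟩ := exists_mulOp μ (hk.comp hφ) (fun x => hD (φ x))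
    exact ⟨F, hFm, starIntertwines_mulOp hφ hw hT hac (hk.comp hφ) hk (fun x => hD (φ x)) hD hF hG
      (.of_forall fun _ => rfl)⟩

end Range

end WeightedComposition

theorem mainTheorem6 {X : Type*} [MeasurableSpace X] (μ : Measure X) [SigmaFinite μ]
    (φ : X → X) (w : X → ℂ) (hφ : Measurable φ) (hw : Measurable w)
    (hac : WeightedComposition.IsAdmissible μ φ w)
    (T : Lp ℂ 2 μ →L[ℂ] Lp ℂ 2 μ)
    (hT : WeightedComposition.wco μ φ w hφ hw hac =
      LinearMap.toPMap (T : Lp ℂ 2 μ →ₗ[ℂ] Lp ℂ 2 μ) ⊤)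
    (hinj : Function.Injective T) (hdense : DenseRange T) :
    (WeightedComposition.condExpOp μ φ w hφ =
        ContinuousLinearMap.id ℂ (Lp ℂ 2 (WeightedComposition.weightedMeasure μ w)) ∧
      ∀ f : X → ℝ≥0∞, Measurable f →
        WeightedComposition.condExpNonneg μ φ w f
          =ᵐ[WeightedComposition.weightedMeasure μ w] f) ∧
    WeightedComposition.IsCentered T ∧
    WeightedComposition.IsTypeIVCentered T 
:= by
  have hT' := WeightedComposition.apply_eq_of_wco_eq hφ hw hac hT
  have hcent := WeightedComposition.isCentered_of_denseRange hφ hw hT' hac hdense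
  exact ⟨⟨WeightedComposition.condExpOp_eq_id hφ hw hT' hdense, fun _ hf =>
    WeightedComposition.condExpNonneg_ae_eq hφ hw hT' hac hdense hf⟩, hcent, hcent,
    WeightedComposition.exists_isPhase_mem_unitary hinj hdense⟩
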